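/- Let $A\in\mathbb{R}^{m\times n}$, $b\in\mathbb{R}^m$, $c\in\mathbb{R}^n$, and consider the linear program $\min\{c^\top x : Ax=b,\ x\ge 0\}$. Put $V_p:=\{x\in\mathbb{R}^n : Ax=b\}$ and $\mathcal{F}_p:=V_p\cap\mathbb{R}^n_+$, and let $\mathcal{X}^\star:=\arg\min_{x\in\mathcal{F}_p}c^\top x$ be the set of optimal solutions. Assume that $\mathcal{X}^\star\neq\emptyset$ and that $\mathcal{F}_p\setminus\mathcal{X}^\star\neq\emptyset$. Let $H_p^\star:=\{x\in\mathbb{R}^n : c^\top x=c^\top x^\star\}$ for $x^\star\in\mathcal{X}^\star$, let $\operatorname{Dist}$ denote Euclidean distance, and define $$G(x):=\frac{\operatorname{Dist}(x,\,V_p\cap H_p^\star)}{\operatorname{Dist}(x,\,\mathcal{X}^\star)}\quad(x\in\mathcal{F}_p\setminus\mathcal{X}^\star),\qquad \mu_p:=\inf_{x\in\mathcal{F}_p\setminus\mathcal{X}^\star}G(x).$$ An edge of $\mathcal{F}_p$ is a one-dimensional face of $\mathcal{F}_p$; write $[v^1,v^2]$ for the line segment joining $v^1$ and $v^2$, and $[v;r]:=\{v+\theta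 r:\theta\ge 0\}$. Let $\mathcal{M}_1$ be the set of edges of $\mathcal{F}_p$ of the form $[x^\star,\tilde x]$ with $x^\star\in\mathcal{X}^\star$ and $\tilde x\notin\mathcal{X}^\star$, and let $\mathcal{M}_2$ be the set of edges of $\mathcal{F}_p$ of the form $[x^\star;r]$ with $x^\star\in\mathcal{X}^\star$ and $r$ normalized by $c^\top r=1$. Then $\mathcal{M}_1$ and $\mathcal{M}_2$ are finite, and for every $\bar\varepsilon>0$, $$\mu_p=\min\Big(\{G(\tilde x):[x^\star,\tilde x]\in\mathcal{M}_1\}\cup\{G(x^\star+\bar\varepsilon r):[x^\star;r]\in\mathcal{M}_2\}\Big),$$ where, in particular, the set on the right-hand side is nonempty, so that the minimum is attained. -/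

import Mathlib

namespace LPSharp

open scoped Matrix

noncomputable section

/-- The affine subspace `V_p = {x : A x = b}` of `ℝⁿ` (with its Euclidean norm). -/
def affineSet {m n : ℕ} (A : Matrix (Fin m) (Fin n) ℝ) (b : Fin m → ℝ) :
    Set (EuclideanSpace ℝ (Fin n)) :=
  {x | A *ᵥ x.ofLp = b}

/-- The feasible set `F_p = V_p ∩ ℝⁿ₊` of the linear program
`min cᵀx  s.t.  A x = b, x ≥ 0`. -/
def feasibleSet {m n : ℕ} (A : Matrix (Fin m) (Fin n) ℝ) (b : Fin m → ℝ) :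
    Set (EuclideanSpace ℝ (Fin n)) :=
  {x | x ∈ affineSet A b ∧ ∀ i, 0 ≤ x i}

/-- The optimal solution set `X⋆`, the set of minimizers of `cᵀx` over `F_p`. -/
def optimalSet {m n : ℕ} (A : Matrix (Fin m) (Fin n) ℝ) (b : Fin m → ℝ)
    (c : EuclideanSpace ℝ (Fin n)) : Set (EuclideanSpace ℝ (Fin n)) :=
  {x | x ∈ feasibleSet A b ∧ ∀ y ∈ feasibleSet A b, inner ℝ c x ≤ inner ℝ c y}

/-- The optimal objective hyperplane `H_p⋆ = {x : cᵀx = cᵀx⋆}` for an `x⋆ ∈ X⋆`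
(all optimal solutions have the same objective value, so the choice of `x⋆` is immaterial). -/
def optimalHyperplane {m n : ℕ} (A : Matrix (Fin m) (Fin n) ℝ) (b : Fin m → ℝ)
    (c : EuclideanSpace ℝ (Fin n)) : Set (EuclideanSpace ℝ (Fin n)) :=
  {x | ∃ xs ∈ optimalSet A b c, inner ℝ c x = inner ℝ c xs}

/-- The sharpness ratio `G(x) = Dist(x, V_p ∩ H_p⋆) / Dist(x, X⋆)`. -/
def sharpnessAt {m n : ℕ} (A : Matrix (Fin m) (Fin n) ℝ) (b : Fin m → ℝ)
    (c x : EuclideanSpace ℝ (Fin n)) : ℝ :=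
  Metric.infDist x (affineSet A b ∩ optimalHyperplane A b c) /
    Metric.infDist x (optimalSet A b c)

/-- The LP sharpness `μ_p`, the infimum of `G` over `F_p \ X⋆`. -/
def lpSharpness {m n : ℕ} (A : Matrix (Fin m) (Fin n) ℝ) (b : Fin m → ℝ)
    (c : EuclideanSpace ℝ (Fin n)) : ℝ :=
  sInf (sharpnessAt A b c '' (feasibleSet A b \ optimalSet A b c))

/-- An edge of a polyhedron `P` is a one-dimensional face of `P`. The nonempty faces are the
sets of maximizers over `P` of a linear functional, that is, `P` itself and the
intersections of `P` with its supporting hyperplanes. -/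
def IsEdge {n : ℕ} (P E : Set (EuclideanSpace ℝ (Fin n))) : Prop :=
  IsExposed ℝ P E ∧ Module.finrank ℝ (vectorSpan ℝ E) = 1

/-- The half-line `[v; r] = {v + t r : t ≥ 0}`. -/
def halfLine {n : ℕ} (v r : EuclideanSpace ℝ (Fin n)) : Set (EuclideanSpace ℝ (Fin n)) :=
  {x | ∃ t : ℝ, 0 ≤ t ∧ x = v + t • r}

/-- The bounded edges `[v¹, v²]` of `F_p` emanating away from `X⋆`: `v¹ ∈ X⋆` and `v² ∉ X⋆`.
Each such edge is recorded by its (uniquely determined) ordered pair `(v¹, v²)`. -/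
def emanatingSegments {m n : ℕ} (A : Matrix (Fin m) (Fin n) ℝ) (b : Fin m → ℝ)
    (c : EuclideanSpace ℝ (Fin n)) :
    Set (EuclideanSpace ℝ (Fin n) × EuclideanSpace ℝ (Fin n)) :=
  {e | IsEdge (feasibleSet A b) (segment ℝ e.1 e.2) ∧
    e.1 ∈ optimalSet A b c ∧ e.2 ∉ optimalSet A b c}

/-- The unbounded edges `[v; r]` of `F_p` emanating away from `X⋆`: `v ∈ X⋆` and, as a
normalization of the direction, `cᵀr = 1`. Each such edge is recorded by its (uniquely
determined) pair `(v, r)`. -/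
def emanatingRays {m n : ℕ} (A : Matrix (Fin m) (Fin n) ℝ) (b : Fin m → ℝ)
    (c : EuclideanSpace ℝ (Fin n)) :
    Set (EuclideanSpace ℝ (Fin n) × EuclideanSpace ℝ (Fin n)) :=
  {f | IsEdge (feasibleSet A b) (halfLine f.1 f.2) ∧
    f.1 ∈ optimalSet A b c ∧ inner ℝ c f.2 = 1}

end

end LPSharp

/-!
On `V_p` the distance to `V_p ∩ H_p⋆` is proportional to the optimality gap `g x = cᵀx - cᵀx⋆`
(`infDist_hyperplane_mul_gap_le`), so minimizing `G` over the non-optimal feasible points amounts to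
maximizing `D / g`, where `D` is the distance to `X⋆`: a convex function, zero on `X⋆`, that does
not increase along recession directions of `X⋆`.

Moving a feasible point `x` towards its projection onto `X⋆` does not decrease `D / g`
(`mul_infDist_le_infDist_lineMap`), so `x` may be assumed to lie in a slice `g = δ`, where `δ` is
at most `ε` and smaller than the gap of each of the finitely many non-optimal vertices
(`exists_gap_lt_vertices`). On the slice, `D` is dominated by its value at a vertex of the slice
(`exists_sliceVertex_infDist_ge`): from a point that is no vertex, a line inside the slice either
meets the boundary at both ends, and convexity applies, or it contains a recession direction of
`X⋆`. In both cases the number of nonzero coordinates drops.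

A vertex `x` of the slice lies on an edge of the feasible set, in direction `d` with `cᵀd = 1`
(`exists_edge_of_sliceVertex`). Going down along `-d` ends at a vertex `p` of gap below `δ`, hence
in `X⋆`; going up along `d` either ends at a vertex `v` or never ends. Convexity along this edge
shows that `D / g` at `x` is at most its value at `v`, or at `p + ε d` respectively. There are
finitely many edges because an exposed face of the feasible set consists of the feasible points
whose support is contained in a given set (`exists_support_eq_of_isExposed`).
-/

namespace LPSharp

open scoped Matrix

variable {m n : ℕ} {A : Matrix (Fin m) (Fin n) ℝ} {b : Fin m → ℝ} {c : EuclideanSpace ℝ (Fin n)}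

/-! ### Feasible and optimal points -/

lemma mem_feasibleSet_add_smul {x d : EuclideanSpace ℝ (Fin n)} {t : ℝ}
    (hx : x ∈ feasibleSet A b) (hd : A *ᵥ d.ofLp = 0) (h : ∀ i, 0 ≤ x i + t * d i) :
    x + t • d ∈ feasibleSet A b := by
  refine ⟨?_, fun i => by simpa using h i⟩
  have hx' : A *ᵥ x.ofLp = b := hx.1
  simp [affineSet, Matrix.mulVec_add, Matrix.mulVec_smul, hd, hx']

lemma mulVec_sub_eq_zero {x y : EuclideanSpace ℝ (Fin n)}
    (hx : x ∈ affineSet A b) (hy : y ∈ affineSet A b) : A *ᵥ (x - y).ofLp = 0 := by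
  have hx' : A *ᵥ x.ofLp = b := hx
  have hy' : A *ᵥ y.ofLp = b := hy
  simp [Matrix.mulVec_sub, hx', hy']

lemma convex_feasibleSet : Convex ℝ (feasibleSet A b) := by
  intro x hx y hy s t hs ht hst
  have hx' : A *ᵥ x.ofLp = b := hx.1
  have hy' : A *ᵥ y.ofLp = b := hy.1
  refine ⟨?_, fun i => ?_⟩
  · simp [affineSet, Matrix.mulVec_add, Matrix.mulVec_smul, hx', hy', ← add_smul, hst]
  · have h1 := mul_nonneg hs (hx.2 i)
    have h2 := mul_nonneg ht (hy.2 i)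
    simpa using add_nonneg h1 h2

lemma isClosed_affineSet : IsClosed (affineSet A b) := by
  refine isClosed_eq ?_ continuous_const
  exact Continuous.matrix_mulVec continuous_const (PiLp.continuous_ofLp 2 _)

lemma isClosed_feasibleSet : IsClosed (feasibleSet A b) := by
  have h : feasibleSet A b = affineSet A b ∩ ⋂ i, {x | 0 ≤ x i} := by
    ext x
    rw [Set.mem_inter_iff, Set.mem_iInter]
    rfl
  rw [h]
  exact isClosed_affineSet.inter
    (isClosed_iInter fun i => isClosed_le continuous_const (by fun_prop))

lemma optimalSet_eq {xs : EuclideanSpace ℝ (Fin n)} (hxs : xs ∈ optimalSet A b c) :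
    optimalSet A b c = {x | x ∈ feasibleSet A b ∧ inner ℝ c x = inner ℝ c xs} := by
  ext x
  constructor
  · exact fun h => ⟨h.1, le_antisymm (h.2 _ hxs.1) (hxs.2 _ h.1)⟩
  · exact fun h => ⟨h.1, fun y hy => h.2.le.trans (hxs.2 y hy)⟩

lemma optimalHyperplane_eq {xs : EuclideanSpace ℝ (Fin n)} (hxs : xs ∈ optimalSet A b c) :
    optimalHyperplane A b c = {x | inner ℝ c x = inner ℝ c xs} := by
  ext x
  constructor
  · rintro ⟨y, hy, h⟩
    rw [optimalSet_eq hxs] at hy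
    exact h.trans hy.2
  · exact fun h => ⟨xs, hxs, h⟩

lemma inner_lt_of_notMem_optimalSet {xs x : EuclideanSpace ℝ (Fin n)}
    (hxs : xs ∈ optimalSet A b c) (hx : x ∈ feasibleSet A b) (hx' : x ∉ optimalSet A b c) :
    inner ℝ c xs < inner ℝ c x := by
  refine lt_of_le_of_ne (hxs.2 x hx) fun h => hx' ?_
  rw [optimalSet_eq hxs]
  exact ⟨hx, h.symm⟩

lemma isClosed_optimalSet (hopt : (optimalSet A b c).Nonempty) : IsClosed (optimalSet A b c) := by
  obtain ⟨xs, hxs⟩ := hopt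
  rw [optimalSet_eq hxs]
  exact isClosed_feasibleSet.inter (isClosed_eq (by fun_prop) continuous_const)

lemma convex_optimalSet : Convex ℝ (optimalSet A b c) := by
  intro x hx y hy s t hs ht hst
  refine ⟨convex_feasibleSet hx.1 hy.1 hs ht hst, fun z hz => ?_⟩
  rw [inner_add_right, inner_smul_right, inner_smul_right]
  have h1 := mul_le_mul_of_nonneg_left (hx.2 z hz) hs
  have h2 := mul_le_mul_of_nonneg_left (hy.2 z hz) ht
  calc _ ≤ s * inner ℝ c z + t * inner ℝ c z := add_le_add h1 h2
    _ = inner ℝ c z := by rw [← add_mul, hst, one_mul]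

/-! ### The distance to the optimal set -/

lemma infDist_combo_le (hopt : (optimalSet A b c).Nonempty) (x y : EuclideanSpace ℝ (Fin n))
    {s t : ℝ} (hs : 0 ≤ s) (ht : 0 ≤ t) (hst : s + t = 1) :
    Metric.infDist (s • x + t • y) (optimalSet A b c) ≤
      s * Metric.infDist x (optimalSet A b c) + t * Metric.infDist y (optimalSet A b c) := by
  have hcl := isClosed_optimalSet hopt
  obtain ⟨p, hp, hxp⟩ := hcl.exists_infDist_eq_dist hopt x
  obtain ⟨q, hq, hyq⟩ := hcl.exists_infDist_eq_dist hopt y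
  rw [hxp, hyq]
  refine (Metric.infDist_le_dist_of_mem (convex_optimalSet hp hq hs ht hst)).trans ?_
  have h : s • x + t • y - (s • p + t • q) = s • (x - p) + t • (y - q) := by module
  rw [dist_eq_norm, dist_eq_norm, dist_eq_norm, h]
  refine (norm_add_le _ _).trans ?_
  rw [norm_smul, norm_smul, Real.norm_of_nonneg hs, Real.norm_of_nonneg ht]

lemma infDist_add_smul_le {p d : EuclideanSpace ℝ (Fin n)} (hp : p ∈ optimalSet A b c)
    {s t : ℝ} (hs : 0 ≤ s) (ht : 0 < t) (hst : s ≤ t) :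
    Metric.infDist (p + s • d) (optimalSet A b c) ≤
      s / t * Metric.infDist (p + t • d) (optimalSet A b c) := by
  have h := infDist_combo_le ⟨p, hp⟩ p (p + t • d) (s := 1 - s / t) (t := s / t)
    (sub_nonneg.2 ((div_le_one ht).2 hst)) (by positivity) (by ring)
  rw [Metric.infDist_zero_of_mem hp, mul_zero, zero_add] at h
  convert h using 2
  rw [smul_add, smul_smul, div_mul_cancel₀ _ ht.ne']
  module

lemma infDist_add_recession_le (hopt : (optimalSet A b c).Nonempty)
    (x : EuclideanSpace ℝ (Fin n)) {d : EuclideanSpace ℝ (Fin n)} (hd : A *ᵥ d.ofLp = 0)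
    (hcd : inner ℝ c d = 0) (hd0 : ∀ i, 0 ≤ d i) {t : ℝ} (ht : 0 ≤ t) :
    Metric.infDist (x + t • d) (optimalSet A b c) ≤ Metric.infDist x (optimalSet A b c) := by
  rw [Metric.le_infDist hopt]
  intro q hq
  have hq' : q + t • d ∈ optimalSet A b c := by
    refine ⟨mem_feasibleSet_add_smul hq.1 hd fun i => add_nonneg (hq.1.2 i)
      (mul_nonneg ht (hd0 i)), fun y hy => ?_⟩
    rw [inner_add_right, inner_smul_right, hcd, mul_zero, add_zero]
    exact hq.2 y hy
  simpa using Metric.infDist_le_dist_of_mem (x := x + t • d) hq'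

/-- Contracting a point towards its nearest point `p` in a set scales its distance to the set
by the same factor; only the lower bound is needed. -/
lemma mul_infDist_le_infDist_lineMap {s : Set (EuclideanSpace ℝ (Fin n))}
    {x p : EuclideanSpace ℝ (Fin n)} (hp : Metric.infDist x s = dist x p) {t : ℝ} (ht : t ≤ 1) :
    t * Metric.infDist x s ≤ Metric.infDist (p + t • (x - p)) s := by
  have h := Metric.infDist_le_infDist_add_dist (s := s) (x := x) (y := p + t • (x - p))
  have h2 : dist x (p + t • (x - p)) = (1 - t) * Metric.infDist x s := by
    rw [hp, dist_eq_norm, dist_eq_norm, show x - (p + t • (x - p)) = (1 - t) • (x - p) by module,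
      norm_smul, Real.norm_of_nonneg (by linarith)]
  rw [h2] at h
  linarith

/-! ### The distance to the optimal hyperplane -/

/-- Half of the proportionality between the distance to `V_p ∩ H_p⋆` and the optimality gap;
the other half is obtained by exchanging `x` and `y`. -/
lemma infDist_hyperplane_mul_gap_le {xs x y : EuclideanSpace ℝ (Fin n)}
    (hxs : xs ∈ optimalSet A b c) (hx : x ∈ affineSet A b) (hy : y ∈ affineSet A b)
    (hgx : inner ℝ c xs < inner ℝ c x) (hgy : inner ℝ c xs < inner ℝ c y) :
    Metric.infDist y (affineSet A b ∩ optimalHyperplane A b c) * (inner ℝ c x - inner ℝ c xs) ≤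
    Metric.infDist x (affineSet A b ∩ optimalHyperplane A b c) *
      (inner ℝ c y - inner ℝ c xs) := by
  have hgx' := sub_pos.2 hgx
  have hgy' := sub_pos.2 hgy
  rw [← le_div_iff₀ hgx', mul_div_assoc, ← div_le_iff₀ (by positivity)]
  have hne : (affineSet A b ∩ {z | inner ℝ c z = inner ℝ c xs}).Nonempty := ⟨xs, hxs.1.1, rfl⟩
  rw [optimalHyperplane_eq hxs, Metric.le_infDist hne]
  rintro q ⟨hq, hcq⟩
  rw [div_le_iff₀ (by positivity)]
  set r := (inner ℝ c y - inner ℝ c xs) / (inner ℝ c x - inner ℝ c xs) with hr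
  have hr0 : 0 < r := by positivity
  have hmem : y + r • (q - x) ∈ affineSet A b ∩ {z | inner ℝ c z = inner ℝ c xs} := by
    constructor
    · have h := mulVec_sub_eq_zero hq hx
      have hy' : A *ᵥ y.ofLp = b := hy
      change A *ᵥ (y + r • (q - x)).ofLp = b
      rw [WithLp.ofLp_add, WithLp.ofLp_smul, Matrix.mulVec_add, Matrix.mulVec_smul, h, hy']
      simp
    · have hcq' : inner ℝ c q = inner ℝ c xs := hcq
      change inner ℝ c (y + r • (q - x)) = inner ℝ c xs
      rw [inner_add_right, inner_smul_right, inner_sub_right, hcq', hr]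
      field_simp
      ring
  refine (Metric.infDist_le_dist_of_mem hmem).trans (le_of_eq ?_)
  rw [dist_eq_norm, dist_eq_norm, show y - (y + r • (q - x)) = r • (x - q) by module, norm_smul,
    Real.norm_of_nonneg hr0.le, mul_comm]

/-- The point with the larger ratio of distance to `X⋆` and optimality gap has the smaller
sharpness ratio. -/
lemma sharpnessAt_le {xs x y : EuclideanSpace ℝ (Fin n)}
    (hxs : xs ∈ optimalSet A b c) (hx : x ∈ feasibleSet A b) (hy : y ∈ feasibleSet A b)
    (hgx : inner ℝ c xs < inner ℝ c x) (hgy : inner ℝ c xs < inner ℝ c y)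
    (h : Metric.infDist x (optimalSet A b c) * (inner ℝ c y - inner ℝ c xs) ≤
      Metric.infDist y (optimalSet A b c) * (inner ℝ c x - inner ℝ c xs)) :
    sharpnessAt A b c y ≤ sharpnessAt A b c x := by
  have hpos : ∀ z, inner ℝ c xs < inner ℝ c z → 0 < Metric.infDist z (optimalSet A b c) := by
    intro z hz
    refine ((isClosed_optimalSet ⟨xs, hxs⟩).notMem_iff_infDist_pos ⟨xs, hxs⟩).1 fun hz' => ?_
    rw [optimalSet_eq hxs] at hz'
    exact hz.ne' hz'.2
  have hDx := hpos x hgx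
  have hDy := hpos y hgy
  have hgx' := sub_pos.2 hgx
  have hgy' := sub_pos.2 hgy
  have hH := infDist_hyperplane_mul_gap_le hxs hx.1 hy.1 hgx hgy
  unfold sharpnessAt
  rw [div_le_div_iff₀ hDy hDx]
  have hHx : 0 ≤ Metric.infDist x (affineSet A b ∩ optimalHyperplane A b c) :=
    Metric.infDist_nonneg
  refine le_of_mul_le_mul_right ?_ hgx'
  calc _ = Metric.infDist y (affineSet A b ∩ optimalHyperplane A b c) *
        (inner ℝ c x - inner ℝ c xs) * Metric.infDist x (optimalSet A b c) := by ring
    _ ≤ Metric.infDist x (affineSet A b ∩ optimalHyperplane A b c) *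
        (inner ℝ c y - inner ℝ c xs) * Metric.infDist x (optimalSet A b c) := by gcongr
    _ = Metric.infDist x (affineSet A b ∩ optimalHyperplane A b c) *
        (Metric.infDist x (optimalSet A b c) * (inner ℝ c y - inner ℝ c xs)) := by ring
    _ ≤ Metric.infDist x (affineSet A b ∩ optimalHyperplane A b c) *
        (Metric.infDist y (optimalSet A b c) * (inner ℝ c x - inner ℝ c xs)) := by gcongr
    _ = _ := by ring

/-! ### Moving to the boundary of the feasible set -/

/-- The ratio test: along a direction with a negative coordinate that is supported in the support
of the feasible point `x`, one stays feasible until a positive coordinate vanishes. -/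
lemma exists_step_to_boundary {x d : EuclideanSpace ℝ (Fin n)} (hx : x ∈ feasibleSet A b)
    (hd : A *ᵥ d.ofLp = 0) (hsupp : ∀ i, x i = 0 → d i = 0) (hneg : ∃ i, d i < 0) :
    ∃ t : ℝ, 0 < t ∧ x + t • d ∈ feasibleSet A b ∧ ∃ i, x i + t * d i = 0 ∧ d i < 0 := by
  obtain ⟨i, hi, hmin⟩ := Set.exists_min_image {i | d i < 0} (fun i => x i / (-d i))
    (Set.toFinite _) hneg
  have hi' : d i < 0 := hi
  have hxi : 0 < x i := lt_of_le_of_ne (hx.2 i) fun h => hi'.ne (hsupp i h.symm)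
  refine ⟨x i / (-d i), div_pos hxi (neg_pos.2 hi'), mem_feasibleSet_add_smul hx hd fun j => ?_,
    i, ?_, hi'⟩
  · rcases lt_or_ge (d j) 0 with hj | hj
    · have h := (le_div_iff₀ (neg_pos.2 hj)).1 (hmin j hj)
      linarith
    · exact add_nonneg (hx.2 j) (mul_nonneg (div_pos hxi (neg_pos.2 hi')).le hj)
  · have := hi'.ne
    field_simp
    ring

open Classical in
/-- The number of nonzero coordinates. -/
noncomputable def supportCard (x : EuclideanSpace ℝ (Fin n)) : ℕ :=
  (Finset.univ.filter fun i => x i ≠ 0).card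

lemma supportCard_add_smul_lt {x d : EuclideanSpace ℝ (Fin n)} {t : ℝ}
    (hsupp : ∀ i, x i = 0 → d i = 0) (h : ∃ i, x i + t * d i = 0 ∧ d i < 0) :
    supportCard (x + t • d) < supportCard x := by
  classical
  obtain ⟨i, hi, hdi⟩ := h
  refine Finset.card_lt_card ((Finset.ssubset_iff_of_subset fun j hj => ?_).2 ⟨i, ?_, ?_⟩)
  · rw [Finset.mem_filter] at hj ⊢
    refine ⟨Finset.mem_univ _, fun h0 => hj.2 ?_⟩
    simp [h0, hsupp j h0]
  · simpa using fun h0 => hdi.ne (hsupp i h0)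
  · exact fun h => (Finset.mem_filter.1 h).2 (by simpa using hi)

/-- Any feasible point is dominated, as far as the distance to `X⋆` is concerned, by a vertex of
the slice of the feasible set on which `cᵀx` is constant. Being a vertex is expressed
algebraically: no nonzero direction of the slice is supported in the support of the point. -/
lemma exists_sliceVertex_infDist_ge (hopt : (optimalSet A b c).Nonempty)
    {y : EuclideanSpace ℝ (Fin n)} (hy : y ∈ feasibleSet A b) :
    ∃ x ∈ feasibleSet A b, inner ℝ c x = inner ℝ c y ∧
      Metric.infDist y (optimalSet A b c) ≤ Metric.infDist x (optimalSet A b c) ∧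
      ∀ d : EuclideanSpace ℝ (Fin n), A *ᵥ d.ofLp = 0 → inner ℝ c d = 0 →
        (∀ i, x i = 0 → d i = 0) → d = 0 := by
  induction hk : supportCard y using Nat.strong_induction_on generalizing y with
  | _ k ih =>
  subst hk
  by_cases hv : ∀ d : EuclideanSpace ℝ (Fin n), A *ᵥ d.ofLp = 0 → inner ℝ c d = 0 →
      (∀ i, y i = 0 → d i = 0) → d = 0
  · exact ⟨y, hy, rfl, le_rfl, hv⟩
  push Not at hv
  obtain ⟨d, hd, hcd, hsupp, hd0⟩ := hv
  have key : ∀ d : EuclideanSpace ℝ (Fin n), A *ᵥ d.ofLp = 0 → inner ℝ c d = 0 →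
      (∀ i, y i = 0 → d i = 0) → (∃ i, d i < 0) → ∃ t : ℝ, 0 < t ∧
      ∃ x ∈ feasibleSet A b, inner ℝ c x = inner ℝ c y ∧
      Metric.infDist (y + t • d) (optimalSet A b c) ≤ Metric.infDist x (optimalSet A b c) ∧
      ∀ d : EuclideanSpace ℝ (Fin n), A *ᵥ d.ofLp = 0 → inner ℝ c d = 0 →
        (∀ i, x i = 0 → d i = 0) → d = 0 := by
    intro d hd hcd hsupp hneg
    obtain ⟨t, ht, hF, hi⟩ := exists_step_to_boundary hy hd hsupp hneg
    obtain ⟨x, hx, hcx, hDx, hvx⟩ := ih _ (supportCard_add_smul_lt hsupp hi) hF rfl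
    refine ⟨t, ht, x, hx, ?_, hDx, hvx⟩
    rw [hcx, inner_add_right, inner_smul_right, hcd, mul_zero, add_zero]
  have hd' : A *ᵥ (-d).ofLp = 0 := by simp [Matrix.mulVec_neg, hd]
  have hcd' : inner ℝ c (-d) = 0 := by rw [inner_neg_right, hcd, neg_zero]
  have hsupp' : ∀ i, y i = 0 → (-d) i = 0 := fun i hi => by simp [hsupp i hi]
  by_cases hneg : ∃ i, d i < 0
  · obtain ⟨t, ht, x, hx, hcx, hDx, hvx⟩ := key d hd hcd hsupp hneg
    by_cases hpos : ∃ i, (-d) i < 0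
    · obtain ⟨s, hs, x', hx', hcx', hDx', hvx'⟩ := key (-d) hd' hcd' hsupp' hpos
      have hcomb := infDist_combo_le hopt (y + t • d) (y + s • (-d)) (s := s / (s + t))
        (t := t / (s + t)) (by positivity) (by positivity) (by field_simp)
      have hy' : (s / (s + t)) • (y + t • d) + (t / (s + t)) • (y + s • (-d)) = y := by
        match_scalars
        · field_simp
        · field_simp
          ring
      rw [hy'] at hcomb
      have hst : s / (s + t) + t / (s + t) = 1 := by field_simp
      have h1 : 0 ≤ s / (s + t) := by positivity
      have h2 : 0 ≤ t / (s + t) := by positivity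
      rcases le_total (Metric.infDist x (optimalSet A b c))
        (Metric.infDist x' (optimalSet A b c)) with h | h
      · refine ⟨x', hx', hcx', hcomb.trans ?_, hvx'⟩
        calc _ ≤ s / (s + t) * Metric.infDist x' (optimalSet A b c) +
              t / (s + t) * Metric.infDist x' (optimalSet A b c) :=
            add_le_add (mul_le_mul_of_nonneg_left (hDx.trans h) h1)
              (mul_le_mul_of_nonneg_left hDx' h2)
          _ = _ := by rw [← add_mul, hst, one_mul]
      · refine ⟨x, hx, hcx, hcomb.trans ?_, hvx⟩
        calc _ ≤ s / (s + t) * Metric.infDist x (optimalSet A b c) +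
              t / (s + t) * Metric.infDist x (optimalSet A b c) :=
            add_le_add (mul_le_mul_of_nonneg_left hDx h1)
              (mul_le_mul_of_nonneg_left (hDx'.trans h) h2)
          _ = _ := by rw [← add_mul, hst, one_mul]
    · push Not at hpos
      refine ⟨x, hx, hcx, le_trans ?_ hDx, hvx⟩
      have h := infDist_add_recession_le hopt (y + t • d) hd' hcd' hpos ht.le
      simpa using h
  · push Not at hneg
    have hpos : ∃ i, (-d) i < 0 := by
      by_contra! h
      refine hd0 (PiLp.ext fun i => le_antisymm ?_ (hneg i))
      simpa using h i
    obtain ⟨t, ht, x, hx, hcx, hDx, hvx⟩ := key (-d) hd' hcd' hsupp' hpos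
    refine ⟨x, hx, hcx, le_trans ?_ hDx, hvx⟩
    have h := infDist_add_recession_le hopt (y + t • (-d)) hd hcd hneg ht.le
    simpa using h

/-! ### Vertices -/

variable (A b) in
/-- The vertices (basic feasible solutions) of the feasible set, in algebraic form: the feasible
points whose support carries no nonzero element of the kernel of `A`. -/
def vertices : Set (EuclideanSpace ℝ (Fin n)) :=
  {x | x ∈ feasibleSet A b ∧
    ∀ d : EuclideanSpace ℝ (Fin n), A *ᵥ d.ofLp = 0 → (∀ i, x i = 0 → d i = 0) → d = 0}

lemma finite_vertices : (vertices A b).Finite := by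
  refine Set.Finite.of_injOn (f := fun x => {i | x i = 0}) (t := Set.univ)
    (fun _ _ => Set.mem_univ _) (fun x hx y hy hxy => ?_) Set.finite_univ
  refine sub_eq_zero.1 (hx.2 _ (mulVec_sub_eq_zero hx.1.1 hy.1.1) fun i hi => ?_)
  have hyi : y i = 0 := (Set.ext_iff.1 hxy i).1 hi
  simp [hi, hyi]

lemma exists_gap_lt_vertices {xs : EuclideanSpace ℝ (Fin n)} (hxs : xs ∈ optimalSet A b c)
    {η : ℝ} (hη : 0 < η) :
    ∃ δ : ℝ, 0 < δ ∧ δ ≤ η ∧ ∀ v ∈ vertices A b, v ∉ optimalSet A b c →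
      δ < inner ℝ c v - inner ℝ c xs := by
  have h : ∀ᶠ δ : ℝ in nhdsWithin 0 (Set.Ioi 0), ∀ v ∈ vertices A b, v ∉ optimalSet A b c →
      δ < inner ℝ c v - inner ℝ c xs := by
    refine (Filter.eventually_all_finite finite_vertices).2 fun v hv => ?_
    by_cases hvo : v ∈ optimalSet A b c
    · exact Filter.Eventually.of_forall fun δ hvo' => absurd hvo hvo'
    · have hlt := sub_pos.2 (inner_lt_of_notMem_optimalSet hxs hv.1 hvo)
      filter_upwards [nhdsWithin_le_nhds (Iio_mem_nhds hlt)] with δ hδ _ using hδ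
  obtain ⟨δ, hδ, hδη, hδ0⟩ := (h.and (Filter.Eventually.and
    (nhdsWithin_le_nhds (Iic_mem_nhds hη)) self_mem_nhdsWithin)).exists
  exact ⟨δ, hδ0, hδη, hδ⟩

/-! ### Edges -/

/-- The face is exposed by minus the sum of the coordinates that vanish at `x`. -/
lemma isExposed_support (x : EuclideanSpace ℝ (Fin n)) (hx : x ∈ feasibleSet A b) :
    IsExposed ℝ (feasibleSet A b) {y | y ∈ feasibleSet A b ∧ ∀ i, x i = 0 → y i = 0} := by
  classical
  intro _
  have hl : ∀ y : EuclideanSpace ℝ (Fin n),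
      (-∑ i ∈ Finset.univ.filter fun i => x i = 0,
        (EuclideanSpace.proj i : EuclideanSpace ℝ (Fin n) →L[ℝ] ℝ)) y =
      -∑ i ∈ Finset.univ.filter fun i => x i = 0, y i := by
    intro y
    simp
  refine ⟨-∑ i ∈ Finset.univ.filter fun i => x i = 0, EuclideanSpace.proj i, ?_⟩
  ext y
  simp only [Set.mem_ofPred_eq, hl, neg_le_neg_iff]
  refine and_congr_right fun hy => ⟨fun h z hz => ?_, fun h i hi => ?_⟩
  · rw [Finset.sum_eq_zero fun i hi => h i (Finset.mem_filter.1 hi).2]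
    exact Finset.sum_nonneg fun i _ => hz.2 i
  · have h0 := h x hx
    rw [Finset.sum_eq_zero (f := fun i => x i) fun i hi => (Finset.mem_filter.1 hi).2] at h0
    have h1 := (Finset.sum_eq_zero_iff_of_nonneg fun i _ => hy.2 i).1
      (le_antisymm h0 (Finset.sum_nonneg fun i _ => hy.2 i))
    exact h1 i (by simp [hi])

/-- An exposed face is determined by the support of one of its points of maximal support, which
plays the role of a relative interior point. -/
lemma exists_support_eq_of_isExposed {E : Set (EuclideanSpace ℝ (Fin n))}
    (hE : IsExposed ℝ (feasibleSet A b) E) (hne : E.Nonempty) :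
    ∃ z : EuclideanSpace ℝ (Fin n),
      E = {y | y ∈ feasibleSet A b ∧ ∀ i, z i = 0 → y i = 0} := by
  have hconv : Convex ℝ E := hE.convex convex_feasibleSet
  obtain ⟨l, hl⟩ := hE hne
  have hEF : ∀ y ∈ E, y ∈ feasibleSet A b := fun y hy => by rw [hl] at hy; exact hy.1
  obtain ⟨S, ⟨z, hz, rfl⟩, hmin⟩ := Set.Finite.exists_minimal
    (s := (fun z : EuclideanSpace ℝ (Fin n) => {i | z i = 0}) '' E) (Set.toFinite _)
    (hne.image _)
  refine ⟨z, Set.Subset.antisymm (fun y hy => ⟨hEF y hy, fun i hi => ?_⟩) fun y hy => ?_⟩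
  · -- The support of the midpoint of `y` and `z` contains both supports.
    have hmid := hconv hy hz (a := 1 / 2) (b := 1 / 2) (by norm_num) (by norm_num) (by norm_num)
    have hcoord : ∀ j, ((1 / 2 : ℝ) • y + (1 / 2 : ℝ) • z) j = 0 → y j = 0 ∧ z j = 0 := by
      intro j hj
      have h1 := (hEF y hy).2 j
      have h2 := (hEF z hz).2 j
      simp only [PiLp.add_apply, PiLp.smul_apply, smul_eq_mul] at hj
      constructor <;> linarith
    have hsub := hmin ⟨_, hmid, rfl⟩ fun j hj => (hcoord j hj).2
    exact (hcoord i (hsub hi)).1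
  · -- Prolonging the segment from `y` to `z` slightly beyond `z` stays feasible.
    have hstep : ∃ t : ℝ, 0 < t ∧ z + t • (z - y) ∈ feasibleSet A b := by
      have hker := mulVec_sub_eq_zero (hEF z hz).1 hy.1.1
      by_cases hneg : ∃ i, (z - y) i < 0
      · obtain ⟨t, ht, hF, _⟩ := exists_step_to_boundary (hEF z hz) hker
          (fun i hi => by simp [hi, hy.2 i hi]) hneg
        exact ⟨t, ht, hF⟩
      · push Not at hneg
        exact ⟨1, one_pos, mem_feasibleSet_add_smul (hEF z hz) hker fun i =>
          add_nonneg ((hEF z hz).2 i) (mul_nonneg zero_le_one (hneg i))⟩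
    obtain ⟨t, ht, hF⟩ := hstep
    rw [hl] at hz ⊢
    have h := hz.2 _ hF
    rw [map_add, map_smul, map_sub, smul_eq_mul] at h
    have h' : l z ≤ l y := by
      by_contra! hlt
      have := mul_pos ht (sub_pos.2 hlt)
      linarith
    exact ⟨hy.1, fun w hw => (hz.2 w hw).trans h'⟩

lemma finite_isEdge : {E | IsEdge (feasibleSet A b) E}.Finite := by
  refine Set.Finite.subset (Set.toFinite (Set.range fun S : Set (Fin n) =>
    {y | y ∈ feasibleSet A b ∧ ∀ i ∈ S, y i = 0})) ?_
  rintro E ⟨hE, hdim⟩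
  have hne : E.Nonempty := by
    by_contra h
    rw [Set.not_nonempty_iff_eq_empty] at h
    rw [h, vectorSpan_empty, finrank_bot] at hdim
    exact zero_ne_one hdim
  obtain ⟨z, hz⟩ := exists_support_eq_of_isExposed hE hne
  exact ⟨{i | z i = 0}, hz.symm⟩

lemma IsEdge.subset {P E : Set (EuclideanSpace ℝ (Fin n))} (h : IsEdge P E) : E ⊆ P :=
  h.1.subset

lemma finite_emanatingSegments (A : Matrix (Fin m) (Fin n) ℝ) (b : Fin m → ℝ)
    (c : EuclideanSpace ℝ (Fin n)) : (emanatingSegments A b c).Finite := by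
  refine Set.Finite.of_injOn (f := fun e => segment ℝ e.1 e.2) (fun e he => he.1) ?_
    (finite_isEdge (A := A) (b := b))
  rintro ⟨p, v⟩ ⟨hE, hp, hv⟩ ⟨q, w⟩ ⟨hE', hq, hw⟩ h
  simp only at h hE hp hv hE' hq hw
  have hgv := inner_lt_of_notMem_optimalSet hp
    (IsEdge.subset hE (right_mem_segment ℝ p v)) hv
  have hgw := inner_lt_of_notMem_optimalSet hp
    (IsEdge.subset hE' (right_mem_segment ℝ q w)) hw
  have hqp : inner ℝ c q = inner ℝ c p := by
    rw [optimalSet_eq hp] at hq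
    exact hq.2
  have hq1 : q ∈ segment ℝ p v := h ▸ left_mem_segment ℝ q w
  have hw1 : w ∈ segment ℝ p v := h ▸ right_mem_segment ℝ q w
  have hv1 : v ∈ segment ℝ q w := h ▸ right_mem_segment ℝ p v
  rw [segment_eq_image'] at hq1 hw1 hv1
  obtain ⟨s, hs, rfl⟩ := hq1
  simp only [inner_add_right, inner_smul_right, inner_sub_right] at hqp
  have hs0 : s = 0 := by
    have : s * (inner ℝ c v - inner ℝ c p) = 0 := by linarith
    exact (mul_eq_zero.1 this).resolve_right (sub_pos.2 hgv).ne'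
  subst hs0
  obtain ⟨t, ht, rfl⟩ := hw1
  obtain ⟨u, hu, huv⟩ := hv1
  simp only [zero_smul, add_zero, add_sub_cancel_left] at huv ⊢
  have huc := congrArg (inner ℝ c) huv
  simp only [inner_add_right, inner_smul_right, inner_sub_right] at huc
  have hut : u * t = 1 := by
    have : (u * t - 1) * (inner ℝ c v - inner ℝ c p) = 0 := by linear_combination huc
    linarith [(mul_eq_zero.1 this).resolve_right (sub_pos.2 hgv).ne']
  have ht1 : t = 1 := by nlinarith [ht.1, ht.2, hu.1, hu.2]
  simp [ht1]

lemma finite_emanatingRays (A : Matrix (Fin m) (Fin n) ℝ) (b : Fin m → ℝ)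
    (c : EuclideanSpace ℝ (Fin n)) : (emanatingRays A b c).Finite := by
  refine Set.Finite.of_injOn (f := fun f => halfLine f.1 f.2) (fun f hf => hf.1) ?_
    (finite_isEdge (A := A) (b := b))
  rintro ⟨p, d⟩ ⟨hE, hp, hd⟩ ⟨q, r⟩ ⟨hE', hq, hr⟩ h
  simp only at h hE hp hd hE' hq hr
  have hqp : inner ℝ c q = inner ℝ c p := by
    rw [optimalSet_eq hp] at hq
    exact hq.2
  have hq1 : q ∈ halfLine p d := h ▸ ⟨0, le_rfl, by simp⟩
  obtain ⟨s, _, rfl⟩ := hq1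
  rw [inner_add_right, inner_smul_right, hd] at hqp
  have hs0 : s = 0 := by linarith
  subst hs0
  have hr1 : p + r ∈ halfLine p d := h ▸ ⟨1, zero_le_one, by simp⟩
  obtain ⟨t, _, ht⟩ := hr1
  have hrd : r = t • d := add_left_cancel ht
  have ht1 : t = 1 := by
    rw [hrd, inner_smul_right, hd, mul_one] at hr
    exact hr
  simp [hrd, ht1]

/-- A parametrized set of the form `{p + s d : s ∈ T}` with `0, t ∈ T` for some `t ≠ 0` spans a
line. -/
lemma finrank_vectorSpan_eq_one {E : Set (EuclideanSpace ℝ (Fin n))}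
    {p d : EuclideanSpace ℝ (Fin n)} (hE : ∀ y ∈ E, ∃ s : ℝ, y = p + s • d) (hp : p ∈ E)
    {t : ℝ} (ht : t ≠ 0) (hd : d ≠ 0) (hpt : p + t • d ∈ E) :
    Module.finrank ℝ (vectorSpan ℝ E) = 1 := by
  have h : vectorSpan ℝ E = Submodule.span ℝ {d} := by
    refine le_antisymm (Submodule.span_le.2 ?_) ((Submodule.span_singleton_le_iff_mem _ _).2 ?_)
    · rintro _ ⟨y, hy, z, hz, rfl⟩
      obtain ⟨s, rfl⟩ := hE y hy
      obtain ⟨u, rfl⟩ := hE z hz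
      refine Submodule.mem_span_singleton.2 ⟨s - u, ?_⟩
      simp only [vsub_eq_sub]
      module
    · have h := vsub_mem_vectorSpan ℝ hpt hp
      rw [vsub_eq_sub, add_sub_cancel_left] at h
      exact (Submodule.smul_mem_iff _ ht).1 h
  rw [h, finrank_span_singleton hd]

/-- A vertex of a slice `cᵀx - cᵀx⋆ = δ`, where `δ` is below the gaps of all non-optimal vertices
of the feasible set, lies on an edge that emanates from `X⋆`. -/
lemma exists_edge_of_sliceVertex {xs x : EuclideanSpace ℝ (Fin n)} {δ : ℝ}
    (hxs : xs ∈ optimalSet A b c) (hδ : 0 < δ)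
    (hgap : ∀ v ∈ vertices A b, v ∉ optimalSet A b c → δ < inner ℝ c v - inner ℝ c xs)
    (hx : x ∈ feasibleSet A b) (hcx : inner ℝ c x = inner ℝ c xs + δ)
    (hv : ∀ d : EuclideanSpace ℝ (Fin n), A *ᵥ d.ofLp = 0 → inner ℝ c d = 0 →
        (∀ i, x i = 0 → d i = 0) → d = 0) :
    ∃ p d : EuclideanSpace ℝ (Fin n), x = p + δ • d ∧ inner ℝ c d = 1 ∧
      ((p, d) ∈ emanatingRays A b c ∨
        ∃ t, δ ≤ t ∧ (p, p + t • d) ∈ emanatingSegments A b c) := by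
  have hxo : x ∉ optimalSet A b c := by
    rw [optimalSet_eq hxs]
    intro h
    linarith [h.2]
  -- Since `x` is no vertex of the feasible set, it moves along a unique direction `d`.
  obtain ⟨d, hd, hsupp, hcd⟩ : ∃ d : EuclideanSpace ℝ (Fin n), A *ᵥ d.ofLp = 0 ∧
      (∀ i, x i = 0 → d i = 0) ∧ inner ℝ c d = 1 := by
    have hnv : x ∉ vertices A b := fun h => by linarith [hgap x h hxo]
    have hex : ∃ d : EuclideanSpace ℝ (Fin n), A *ᵥ d.ofLp = 0 ∧
        (∀ i, x i = 0 → d i = 0) ∧ d ≠ 0 := by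
      by_contra! h
      exact hnv ⟨hx, h⟩
    obtain ⟨d, hd, hs, h0⟩ := hex
    have hc0 : inner ℝ c d ≠ 0 := fun h => h0 (hv d hd h hs)
    refine ⟨(inner ℝ c d)⁻¹ • d, ?_, fun i hi => by simp [hs i hi], ?_⟩
    · rw [WithLp.ofLp_smul, Matrix.mulVec_smul, hd, smul_zero]
    · rw [inner_smul_right, inv_mul_cancel₀ hc0]
  have hd0 : d ≠ 0 := by
    rintro rfl
    simp at hcd
  have hline : ∀ e : EuclideanSpace ℝ (Fin n), A *ᵥ e.ofLp = 0 →
      (∀ i, x i = 0 → e i = 0) → e = inner ℝ c e • d := by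
    intro e he hs
    refine sub_eq_zero.1 (hv _ ?_ ?_ fun i hi => ?_)
    · rw [WithLp.ofLp_sub, WithLp.ofLp_smul, Matrix.mulVec_sub, Matrix.mulVec_smul, hd, he]
      simp
    · rw [inner_sub_right, inner_smul_right, hcd]
      ring
    · simp [hs i hi, hsupp i hi]
  -- A direction without negative coordinates along which `cᵀx` decreases contradicts optimality.
  have hneg : ∃ i, (-d) i < 0 := by
    by_contra! h
    have hF : x + (2 * δ) • (-d) ∈ feasibleSet A b :=
      mem_feasibleSet_add_smul hx (by simp [Matrix.mulVec_neg, hd])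
        fun i => add_nonneg (hx.2 i) (mul_nonneg (by positivity) (h i))
    have := hxs.2 _ hF
    rw [inner_add_right, inner_smul_right, inner_neg_right, hcd, hcx] at this
    linarith
  obtain ⟨s, hs, hpF, j, hj, hdj⟩ := exists_step_to_boundary hx
    (by simp [Matrix.mulVec_neg, hd]) (fun i hi => by simp [hsupp i hi]) hneg
  set p := x + s • (-d) with hp
  have hpj : p j = 0 := by simpa [hp] using hj
  have hdj0 : d j ≠ 0 := by
    intro h
    simp [h] at hdj
  have hpx : ∀ i, x i = 0 → p i = 0 := fun i hi => by simp [hp, hi, hsupp i hi]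
  have hpv : p ∈ vertices A b := by
    refine ⟨hpF, fun e he hes => ?_⟩
    have h1 : e = inner ℝ c e • d := hline e he fun i hi => hes i (hpx i hi)
    have h2 : inner ℝ c e * d j = 0 := by
      have h3 := hes j hpj
      rw [h1] at h3
      simpa using h3
    rw [h1, (mul_eq_zero.1 h2).resolve_right hdj0, zero_smul]
  have hcp : inner ℝ c p = inner ℝ c xs + δ - s := by
    rw [hp, inner_add_right, inner_smul_right, inner_neg_right, hcd, hcx]
    ring
  have hpo : p ∈ optimalSet A b c := by
    by_contra h
    have := hgap p hpv h
    linarith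
  have hsδ : s = δ := by
    have h := hpo
    rw [optimalSet_eq hxs] at h
    linarith [h.2]
  subst hsδ
  have hxp : x = p + s • d := by
    rw [hp]
    module
  -- The edge: all feasible points supported in the support of `x`.
  have hface := isExposed_support x hx
  have hfaceLine : ∀ y ∈ {y | y ∈ feasibleSet A b ∧ ∀ i, x i = 0 → y i = 0},
      ∃ t : ℝ, 0 ≤ t ∧ y = p + t • d := by
    rintro y ⟨hy, hys⟩
    have h := hline (y - p) (mulVec_sub_eq_zero hy.1 hpF.1)
      fun i hi => by simp [hys i hi, hpx i hi]
    refine ⟨inner ℝ c (y - p), ?_, by rw [← h]; simp⟩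
    rw [inner_sub_right]
    exact sub_nonneg.2 (hpo.2 y hy)
  have hfin : Module.finrank ℝ (vectorSpan ℝ
      {y | y ∈ feasibleSet A b ∧ ∀ i, x i = 0 → y i = 0}) = 1 := by
    refine finrank_vectorSpan_eq_one (p := p) (d := d) (t := s) (fun y hy => ?_) ⟨hpF, hpx⟩ hs.ne'
      hd0 ?_
    · obtain ⟨t, _, ht⟩ := hfaceLine y hy
      exact ⟨t, ht⟩
    · rw [← hxp]
      exact ⟨hx, fun i hi => hi⟩
  refine ⟨p, d, hxp, hcd, ?_⟩
  by_cases hdn : ∃ i, d i < 0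
  · right
    obtain ⟨u, hu, hwF, k, hk, hdk⟩ := exists_step_to_boundary hx hd hsupp hdn
    have hw : x + u • d = p + (s + u) • d := by
      rw [hxp]
      module
    rw [hw] at hwF
    refine ⟨s + u, by linarith, ?_, hpo, ?_⟩
    · have hEq : {y | y ∈ feasibleSet A b ∧ ∀ i, x i = 0 → y i = 0} =
          segment ℝ p (p + (s + u) • d) := by
        refine Set.Subset.antisymm (fun y hy => ?_) fun y hy => ?_
        · obtain ⟨t, ht, rfl⟩ := hfaceLine y hy
          rw [segment_eq_image']
          have htu : t ≤ s + u := by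
            have h1 := hy.1.2 k
            have h2 : p k + s * d k + u * d k = 0 := by
              have h3 := congrArg (fun z : EuclideanSpace ℝ (Fin n) => z k) hxp
              simp only [PiLp.add_apply, PiLp.smul_apply, smul_eq_mul] at h3
              linarith
            simp only [PiLp.add_apply, PiLp.smul_apply, smul_eq_mul] at h1
            by_contra! hlt
            have := mul_lt_mul_of_neg_right hlt hdk
            linarith
          refine ⟨t / (s + u), ⟨by positivity, (div_le_one (by positivity)).2 htu⟩, ?_⟩
          simp only [add_sub_cancel_left]
          rw [smul_smul, div_mul_cancel₀ _ (by positivity)]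
        · refine ⟨convex_feasibleSet.segment_subset hpF hwF hy, fun i hi => ?_⟩
          rw [segment_eq_image'] at hy
          obtain ⟨t, _, rfl⟩ := hy
          simp [hpx i hi, hsupp i hi]
      rw [← hEq]
      exact ⟨hface, hfin⟩
    · rw [optimalSet_eq hpo]
      intro h
      have h2 := h.2
      simp only [inner_add_right, inner_smul_right, hcd] at h2
      linarith
  · left
    push Not at hdn
    refine ⟨?_, hpo, hcd⟩
    have hEq : {y | y ∈ feasibleSet A b ∧ ∀ i, x i = 0 → y i = 0} = halfLine p d := by
      refine Set.Subset.antisymm hfaceLine ?_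
      rintro _ ⟨t, ht, rfl⟩
      exact ⟨mem_feasibleSet_add_smul hpF hd fun i => add_nonneg (hpF.2 i)
        (mul_nonneg ht (hdn i)), fun i hi => by simp [hpx i hi, hsupp i hi]⟩
    simp only
    rw [← hEq]
    exact ⟨hface, hfin⟩

/-! ### Comparison with the edges -/

/-- The values of the sharpness ratio along the edges emanating from `X⋆`: at the far end of
bounded edges, and at parameter `ε` on unbounded ones. -/
noncomputable def edgeSharpness (A : Matrix (Fin m) (Fin n) ℝ) (b : Fin m → ℝ)
    (c : EuclideanSpace ℝ (Fin n)) (ε : ℝ) : Set ℝ :=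
  (fun e => sharpnessAt A b c e.2) '' emanatingSegments A b c ∪
    (fun f => sharpnessAt A b c (f.1 + ε • f.2)) '' emanatingRays A b c

lemma edgeSharpness_subset {ε : ℝ} (hε : 0 < ε) :
    edgeSharpness A b c ε ⊆ sharpnessAt A b c '' (feasibleSet A b \ optimalSet A b c) := by
  rintro _ (⟨e, ⟨hE, _, he⟩, rfl⟩ | ⟨f, ⟨hE, hf, hcf⟩, rfl⟩)
  · exact ⟨e.2, ⟨IsEdge.subset hE (right_mem_segment ℝ _ _), he⟩, rfl⟩
  · refine ⟨_, ⟨IsEdge.subset hE ⟨ε, hε.le, rfl⟩, fun h => ?_⟩, rfl⟩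
    rw [optimalSet_eq hf] at h
    have h2 := h.2
    rw [inner_add_right, inner_smul_right, hcf] at h2
    linarith

lemma exists_edgeSharpness_le {ε : ℝ} (hε : 0 < ε) (hopt : (optimalSet A b c).Nonempty)
    {x : EuclideanSpace ℝ (Fin n)} (hx : x ∈ feasibleSet A b) (hxo : x ∉ optimalSet A b c) :
    ∃ a ∈ edgeSharpness A b c ε, a ≤ sharpnessAt A b c x := by
  obtain ⟨q, hq, hxq⟩ := (isClosed_optimalSet hopt).exists_infDist_eq_dist hopt x
  have hgx := inner_lt_of_notMem_optimalSet hq hx hxo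
  have hgx' := sub_pos.2 hgx
  set g := inner ℝ c x - inner ℝ c q with hg
  obtain ⟨δ, hδ, hδη, hgap⟩ := exists_gap_lt_vertices hq (lt_min hε hgx')
  have hδg : δ / g ≤ 1 := (div_le_one hgx').2 (hδη.trans (min_le_right _ _))
  have hδε : δ ≤ ε := hδη.trans (min_le_left _ _)
  have hyF : q + (δ / g) • (x - q) ∈ feasibleSet A b := by
    have := convex_feasibleSet.add_smul_sub_mem hq.1 hx ⟨by positivity, hδg⟩
    exact this
  have hyD := mul_infDist_le_infDist_lineMap hxq hδg
  obtain ⟨z, hzF, hcz, hzD, hzv⟩ := exists_sliceVertex_infDist_ge hopt hyF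
  have hcz' : inner ℝ c z = inner ℝ c q + δ := by
    rw [hcz, inner_add_right, inner_smul_right, inner_sub_right, ← hg,
      div_mul_cancel₀ _ hgx'.ne']
  obtain ⟨p, d, rfl, hcd, hedge⟩ := exists_edge_of_sliceVertex hq hδ hgap hzF hcz' hzv
  have hDx : Metric.infDist x (optimalSet A b c) * δ ≤
      Metric.infDist (p + δ • d) (optimalSet A b c) * g := by
    have h := mul_le_mul_of_nonneg_right (hyD.trans hzD) hgx'.le
    have h2 : δ / g * Metric.infDist x (optimalSet A b c) * g =
      Metric.infDist x (optimalSet A b c) * δ := by field_simp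
    linarith
  have hcp : inner ℝ c p = inner ℝ c q := by
    rw [inner_add_right, inner_smul_right, hcd] at hcz'
    linarith
  have key : ∀ t, δ ≤ t → p ∈ optimalSet A b c → p + t • d ∈ feasibleSet A b →
      sharpnessAt A b c (p + t • d) ≤ sharpnessAt A b c x := by
    intro t ht hpo hF
    have ht0 : 0 < t := hδ.trans_le ht
    have hgt : inner ℝ c (p + t • d) = inner ℝ c q + t := by
      rw [inner_add_right, inner_smul_right, hcd, hcp, mul_one]
    refine sharpnessAt_le hq hx hF hgx (by linarith) ?_
    rw [hgt, add_sub_cancel_left, ← hg]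
    have h := infDist_add_smul_le (d := d) hpo hδ.le ht0 ht
    have h2 := hDx.trans (mul_le_mul_of_nonneg_right h hgx'.le)
    refine le_of_mul_le_mul_right ?_ hδ
    calc _ = Metric.infDist x (optimalSet A b c) * δ * t := by ring
      _ ≤ δ / t * Metric.infDist (p + t • d) (optimalSet A b c) * g * t := by gcongr
      _ = _ := by field_simp
  rcases hedge with hr | ⟨t, ht, hs⟩
  · exact ⟨_, Or.inr ⟨_, hr, rfl⟩,
      key ε hδε hr.2.1 (IsEdge.subset hr.1 ⟨ε, hε.le, rfl⟩)⟩
  · exact ⟨_, Or.inl ⟨_, hs, rfl⟩,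
      key t ht hs.2.1 (IsEdge.subset hs.1 (right_mem_segment ℝ _ _))⟩

end LPSharp

theorem theorem5p2 {m n : ℕ} (A : Matrix (Fin m) (Fin n) ℝ) (b : Fin m → ℝ)
    (c : EuclideanSpace ℝ (Fin n))
    (hopt : (LPSharp.optimalSet A b c).Nonempty)
    (hnonopt : (LPSharp.feasibleSet A b \ LPSharp.optimalSet A b c).Nonempty)
    (ε : ℝ) (hε : 0 < ε) :
    (LPSharp.emanatingSegments A b c).Finite ∧
    (LPSharp.emanatingRays A b c).Finite ∧
    IsLeast
      ((fun e => LPSharp.sharpnessAt A b c e.2) '' LPSharp.emanatingSegments A b c ∪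
        (fun f => LPSharp.sharpnessAt A b c (f.1 + ε • f.2)) '' LPSharp.emanatingRays A b c)
      (LPSharp.lpSharpness A b c) := by
  have hS := LPSharp.finite_emanatingSegments A b c
  have hR := LPSharp.finite_emanatingRays A b c
  refine ⟨hS, hR, ?_⟩
  change IsLeast (LPSharp.edgeSharpness A b c ε) _
  have hfin : (LPSharp.edgeSharpness A b c ε).Finite := (hS.image _).union (hR.image _)
  have hne : (LPSharp.edgeSharpness A b c ε).Nonempty := by
    obtain ⟨x, hx, hxo⟩ := hnonopt
    obtain ⟨a, ha, _⟩ := LPSharp.exists_edgeSharpness_le hε hopt hx hxo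
    exact ⟨a, ha⟩
  obtain ⟨a, ha, hmin⟩ := Set.exists_min_image _ id hfin hne
  have hleast : IsLeast (LPSharp.sharpnessAt A b c ''
      (LPSharp.feasibleSet A b \ LPSharp.optimalSet A b c)) a := by
    refine ⟨LPSharp.edgeSharpness_subset hε ha, ?_⟩
    rintro _ ⟨x, ⟨hx, hxo⟩, rfl⟩
    obtain ⟨a', ha', hle⟩ := LPSharp.exists_edgeSharpness_le hε hopt hx hxo
    exact (hmin a' ha').trans hle
  rw [LPSharp.lpSharpness, hleast.csInf_eq]
  exact ⟨ha, hmin⟩
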